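/- **The game.** Let $G$ be a finite connected graph. An invisible robber chooses a starting vertex. In each round the cops probe a set of vertices simultaneously and learn the distance in the graph from each of them to the robber; then the robber stays or moves to a neighbor. A (deterministic) strategy chooses the probes of a round from the list of all earlier answers; this list is called the state. The robber set of a state is the set of positions the robber may have right after the last probe, given all the answers. The state is terminating (the cops win) if this set has exactly one element. A strategy is cop-winning if against every route of the robber a terminating state is reached in finite time. The cop strategy graph of a strategy is the tree of all states that can occur, with terminating states as leaves. **The subdivision game.** Let $m\ge 1$ (for instance $m=\eta$, the subdivision number of $G$). Let $G^{1/m}$ be $G$ with every edge replaced by a path (thread) of length $m$. Write $v'$ for the branch vertex of $G^{1/m}$ corresponding to $v\in V(G)$. For a vertex $p$ of $G^{1/m}$ let $\mathrm{CorrEnd}(p)\subseteq V(G)$ consist of the vertices corresponding to the two ends of the thread of $p$, or of $v$ alone if $p=v'$. Let $A_{subs}$ be a strategy on $G^{1/m}$ that makes one probe per round. The restricted robber on $G^{1/m}$ starts at a branch vertex and moves in strides of $m$ rounds. In each stride it either runs straight along a thread to an adjacent branch vertex, or stays at its branch vertex, or goes along a thread to its middle and back (being at distance $\min(j,m-j)$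 from its branch vertex after $j$ moves). Let $H$ be the cop strategy graph of $A_{subs}$ against the restricted robber. Its stride level $l\ge 1$ consists of the states in which a probe of rounds $(l-1)m+1,\dots,lm$ is made; a terminating state belongs to the level of the probe that produced it. For a state $\varphi$, let $SubTree(H,\varphi,L)$ be the set of states of $H$ equal to or below $\varphi$ on the levels in $L$. **The strategy $A_{cop}$ on $G$** (any number of cops is available, so that all its probes can be made). It maintains a set $\Phi$ of states of the subdivision game, at first containing only the initial state. * In round $0$ it probes $\mathrm{CorrEnd}(p)$ for all probes $p$ made by $A_{subs}$ on stride level $1$ of $H$. * In round $i\ge 1$ it probes, for every $\varphi\in\Phi$, the set $\mathrm{CorrEnd}(p)$ for all probes $p$ made by $A_{subs}$ in non-terminating states of $SubTree(H,\varphi,\{i,i+1\})$, and $\mathrm{CorrEnd}(r)$ for the robber's location $r$ of each terminating state in $SubTree(H,\varphi,\{i,i+1\})$. * After round $i\ge1$, let $u,v$ be the unknown positions of the robber in rounds $i-1$ and $i$. Each $\varphi\in\Phi$ is replaced by the state obtained by playing $A_{subs}$ for $m$ further rounds with the answer $$\min_{a\in \mathrm{CorrEnd}(p)}\min\bigl(j+m\,d_G(u,a)+d(a',p),\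 (m-j)+m\,d_G(v,a)+d(a',p)\bigr)$$ to the probe $p$ made after $j$ moves of the stride ($0\le j<m$), where $d$ is the distance in $G^{1/m}$ and only the answers received in rounds $i-1$ and $i$ are used. If moreover no answer about a vertex of $\mathrm{CorrEnd}(p)$, with $p$ probed on level $i$ below $\varphi$, has changed between rounds $i-1$ and $i$, then also the state obtained with the answers $\min_{a\in \mathrm{CorrEnd}(p)}\bigl(m\,d_G(u,a)+d(a',p)\bigr)$ is put in. States that do not occur in $H$ and terminating states are dropped. **Theorem.** If $A_{subs}$ is cop-winning against the restricted robber on $G^{1/m}$, then $A_{cop}$ is cop-winning on $G$ (against the unrestricted robber). The same holds if $A_{subs}$ is cop-winning against the unrestricted robber on $G^{1/m}$. -/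

import Mathlib

namespace RobberLocating

open scoped Classical

/-! ## Locating games

`w t` is the position of the robber when the cops make their `t`-th probe (`t = 0, 1, 2, …`); the
robber moves from `w t` to `w (t + 1)` between two consecutive probes.  `ans p x` is the answer to
the probe `p` when the robber is at `x`.  A deterministic cop strategy chooses the next probe from
all the information that the cops have, that is, from the list of all answers so far (oldest
first).  These lists are the states of the game. -/

/-- A deterministic cop strategy with probes of type `P` and answers of type `O`. -/
abbrev Strategy (P O : Type*) := List O → P

/-- The list of the first `t` answers when the strategy `S` is played against the route `w`. -/
def play {V P O : Type*} (ans : P → V → O) (S : Strategy P O) (w : ℕ → V) : ℕ → List O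
  | 0 => []
  | t + 1 => play ans S w t ++ [ans (S (play ans S w t)) (w t)]

/-- The robber set: the possible positions of the robber right after the last probe of the
state `h`, before its next move, for a robber that uses one of the given `routes`. -/
def robberSet {V P O : Type*} (ans : P → V → O) (routes : Set (ℕ → V)) (S : Strategy P O)
    (h : List O) : Set V :=
  {x | ∃ w ∈ routes, ∃ t, h.length = t + 1 ∧ play ans S w (t + 1) = h ∧ w t = x}

/-- A terminating state: the robber set has exactly one element, and the cops win. -/
def IsTerminating {V P O : Type*} (ans : P → V → O) (routes : Set (ℕ → V)) (S : Strategy P O)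
    (h : List O) : Prop :=
  ∃ x, robberSet ans routes S h = {x}

/-- The strategy `S` locates every robber that uses one of the given `routes`, in finite time. -/
def IsCopWinning {V P O : Type*} (ans : P → V → O) (routes : Set (ℕ → V))
    (S : Strategy P O) : Prop :=
  ∀ w ∈ routes, ∃ t, IsTerminating ans routes S (play ans S w t)

/-- The vertices of the cop strategy graph of `S`: the states that some route leads to, the game
being over at a terminating state.  The graph is a tree rooted at `[]`; the children of `h` are
the vertices of the form `h ++ [o]`, and `φ` is an ancestor of `ψ` iff `φ` is a prefix of `ψ`. -/
def copStrategyGraph {V P O : Type*} (ans : P → V → O) (routes : Set (ℕ → V))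
    (S : Strategy P O) : Set (List O) :=
  {h | (∃ w ∈ routes, play ans S w h.length = h) ∧
    ∀ h', h' <+: h → h' ≠ h → ¬ IsTerminating ans routes S h'}

/-- The routes of an unrestricted robber: in each round it stays or moves to a neighbor. -/
def routes {V : Type*} (G : SimpleGraph V) : Set (ℕ → V) :=
  {w | ∀ t, w (t + 1) = w t ∨ G.Adj (w t) (w (t + 1))}

/-- The answer to a distance probe by one cop. -/
noncomputable def distAns {V : Type*} (G : SimpleGraph V) (p x : V) : ℕ := G.dist p x

/-- The answers to simultaneous distance probes at all vertices of `P`; nothing is learned about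
the distances to the other vertices. -/
noncomputable def multiAns {V : Type*} (G : SimpleGraph V) (P : Set V) (x : V) : V → Option ℕ :=
  fun p => if p ∈ P then some (G.dist p x) else none

/-! ## Subdivisions -/

/-- The vertex at distance `k` from `u` on the thread of length `m` from `u` to `v` is recorded
by its weights: `m - k` at `u` and `k` at `v`. -/
noncomputable def threadPoint {V : Type*} (m : ℕ) (u v : V) (k : ℕ) : V → ℕ :=
  Pi.single u (m - k) + Pi.single v k

/-- The vertices of the subdivision of `G` in which each edge becomes a path of length `m`. -/
def SubdivVertex {V : Type*} (G : SimpleGraph V) (m : ℕ) : Type _ :=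
  {f : V → ℕ // (∃ v, f = Pi.single v m) ∨
    ∃ u v, G.Adj u v ∧ ∃ k ≤ m, f = threadPoint m u v k}

/-- The subdivision of `G` in which each edge becomes a path of length `m`: consecutive vertices
of each thread are adjacent. -/
def subdiv {V : Type*} (G : SimpleGraph V) (m : ℕ) : SimpleGraph (SubdivVertex G m) :=
  SimpleGraph.fromRel fun x y => ∃ u v, G.Adj u v ∧ ∃ k < m,
    x.1 = threadPoint m u v k ∧ y.1 = threadPoint m u v (k + 1)

/-- The branch vertex that corresponds to the vertex `v` of `G`. -/
noncomputable def branch {V : Type*} (G : SimpleGraph V) (m : ℕ) (v : V) : SubdivVertex G m :=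
  ⟨Pi.single v m, Or.inl ⟨v, rfl⟩⟩

/-- The corresponding endpoints of a vertex of the subdivision (where `1 ≤ m`): the two ends of
its thread for an inner vertex of a thread, and `v` itself for the branch vertex of `v`. -/
def corrEnd {V : Type*} {G : SimpleGraph V} {m : ℕ} (p : SubdivVertex G m) : Set V :=
  {a | p.1 a ≠ 0}

/-- The routes of the restricted robber.  It starts at a branch vertex, and its moves are grouped
into strides of `m` moves.  In a stride it runs straight to an adjacent branch vertex, or it stays
where it is, or it goes along a thread to its middle and back. -/
def strideRoutes {V : Type*} (G : SimpleGraph V) (m : ℕ) : Set (ℕ → SubdivVertex G m) :=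
  {w | ∃ b : ℕ → V, ∀ i,
    (G.Adj (b i) (b (i + 1)) ∧
      ∀ j ≤ m, (w (i * m + j)).1 = threadPoint m (b i) (b (i + 1)) j) ∨
    (b (i + 1) = b i ∧ ∀ j ≤ m, w (i * m + j) = branch G m (b i)) ∨
    (b (i + 1) = b i ∧ ∃ c, G.Adj (b i) c ∧
      ∀ j ≤ m, (w (i * m + j)).1 = threadPoint m (b i) c (min j (m - j)))}

/-! ## The strategy for many cops on `G` -/

/-- A one-cop strategy on the subdivision. -/
abbrev SubsStrategy {V : Type*} (G : SimpleGraph V) (m : ℕ) := Strategy (SubdivVertex G m) ℕ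

/-- A strategy on `G` for as many cops as are needed to make all the probes. -/
abbrev MultiStrategy (V : Type*) := Strategy (Set V) (V → Option ℕ)

/-- The cop strategy graph `H` of `A` for the restricted robber. -/
def strideGraph {V : Type*} (G : SimpleGraph V) (m : ℕ) (A : SubsStrategy G m) :
    Set (List ℕ) :=
  copStrategyGraph (distAns (subdiv G m)) (strideRoutes G m) A

/-- The terminating states of `A` for the restricted robber. -/
def IsStrideTerminating {V : Type*} (G : SimpleGraph V) (m : ℕ) (A : SubsStrategy G m)
    (h : List ℕ) : Prop :=
  IsTerminating (distAns (subdiv G m)) (strideRoutes G m) A h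

/-- The states below `φ` in `H` in which `A` makes a probe during stride `l` (`l = 1, 2, …`). -/
def subTree {V : Type*} (G : SimpleGraph V) (m : ℕ) (A : SubsStrategy G m)
    (φ : List ℕ) (l : ℕ) : Set (List ℕ) :=
  {ψ ∈ strideGraph G m A | φ <+: ψ ∧ ¬ IsStrideTerminating G m A ψ ∧ ψ.length / m + 1 = l}

/-- The terminating states below `φ` in `H` that are reached by a probe of stride `l`. -/
def subTreeLeaves {V : Type*} (G : SimpleGraph V) (m : ℕ) (A : SubsStrategy G m)
    (φ : List ℕ) (l : ℕ) : Set (List ℕ) :=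
  {ψ ∈ strideGraph G m A | φ <+: ψ ∧ IsStrideTerminating G m A ψ ∧ (ψ.length - 1) / m + 1 = l}

/-- The corresponding endpoints of the probes of `A` in stride `l` below `φ`. -/
def levelProbes {V : Type*} (G : SimpleGraph V) (m : ℕ) (A : SubsStrategy G m)
    (φ : List ℕ) (l : ℕ) : Set V :=
  ⋃ ψ ∈ subTree G m A φ l, corrEnd (A ψ)

/-- The corresponding endpoints of the robber's locations in the terminating states of
stride `l` below `φ`. -/
def leafProbes {V : Type*} (G : SimpleGraph V) (m : ℕ) (A : SubsStrategy G m)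
    (φ : List ℕ) (l : ℕ) : Set V :=
  ⋃ ψ ∈ subTreeLeaves G m A φ l,
    ⋃ x ∈ robberSet (distAns (subdiv G m)) (strideRoutes G m) A ψ, corrEnd x

/-- The deduced answer to the probe `p` on the subdivision after `j` moves of a stride from `u`
to `v`, where `last a` and `cur a` are the answers on `G` about the distances of `u` and `v`
from `a`: the least length of the paths through an endpoint of the thread of `p` and one of
`u`, `v`. -/
noncomputable def deduceMoves {V : Type*} (G : SimpleGraph V) (m : ℕ)
    (last cur : V → Option ℕ) (j : ℕ) (p : SubdivVertex G m) : ℕ :=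
  sInf {n | ∃ a ∈ corrEnd p, ∃ d,
    (last a = some d ∧ n = j + m * d + (subdiv G m).dist (branch G m a) p) ∨
    (cur a = some d ∧ n = (m - j) + m * d + (subdiv G m).dist (branch G m a) p)}

/-- The deduced answer to the probe `p` on the subdivision if the robber stays. -/
noncomputable def deduceStays {V : Type*} (G : SimpleGraph V) (m : ℕ)
    (last : V → Option ℕ) (p : SubdivVertex G m) : ℕ :=
  sInf {n | ∃ a ∈ corrEnd p, ∃ d,
    last a = some d ∧ n = m * d + (subdiv G m).dist (branch G m a) p}

/-- The state reached from `φ` by `j` further probes of `A`, where the answer to a probe `p`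
after `i` moves of the stride is `f i p`. -/
def advance {V : Type*} {G : SimpleGraph V} {m : ℕ} (A : SubsStrategy G m)
    (f : ℕ → SubdivVertex G m → ℕ) (φ : List ℕ) : ℕ → List ℕ
  | 0 => φ
  | j + 1 => advance A f φ j ++ [f j (A (advance A f φ j))]

/-- The states deduced from `φ` for the end of stride `i`, where `last` and `cur` are the answers
on `G` in rounds `i - 1` and `i`.  If some answer about an endpoint of a probe of `A` in stride `i`
below `φ` has changed, the robber has moved; otherwise it may have moved or stayed. -/
noncomputable def deduceAndUpdate {V : Type*} (G : SimpleGraph V) (m : ℕ) (A : SubsStrategy G m)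
    (last cur : V → Option ℕ) (i : ℕ) (φ : List ℕ) : Set (List ℕ) :=
  if ∃ a ∈ levelProbes G m A φ i, last a ≠ cur a then
    {advance A (deduceMoves G m last cur) φ m}
  else
    {advance A (deduceMoves G m last cur) φ m, advance A (fun _ => deduceStays G m last) φ m}

/-- The states of the subdivision game that are still possible after stride `i`, where `D i` are
the answers on `G` in round `i`.  States that cannot occur and terminating states are dropped. -/
noncomputable def possibleStates {V : Type*} (G : SimpleGraph V) (m : ℕ) (A : SubsStrategy G m)
    (D : ℕ → V → Option ℕ) : ℕ → Set (List ℕ)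
  | 0 => {[]}
  | i + 1 => {ψ | ∃ φ ∈ possibleStates G m A D i,
      ψ ∈ deduceAndUpdate G m A (D i) (D (i + 1)) (i + 1) φ ∧
      ψ ∈ strideGraph G m A ∧ ¬ IsStrideTerminating G m A ψ}

/-- The strategy on `G` that is built from `A`.  In round `0` it probes the corresponding endpoints
of stride level `1` of `H`.  In round `i + 1` it probes the corresponding endpoints of stride
levels `i + 1` and `i + 2` below each state that is possible after stride `i`, and those of the
robber's locations in the terminating states on these levels. -/
noncomputable def copStrategy {V : Type*} (G : SimpleGraph V) (m : ℕ) (A : SubsStrategy G m) :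
    MultiStrategy V :=
  fun hist => match hist.length with
    | 0 => levelProbes G m A [] 1
    | i + 1 => ⋃ φ ∈ possibleStates G m A (fun t => hist.getD t fun _ => none) i,
        ⋃ l ∈ ({i + 1, i + 2} : Set ℕ), levelProbes G m A φ l ∪ leafProbes G m A φ l

end RobberLocating

namespace RobberLocating

open scoped Classical

/-! ### Plays, robber sets and termination. -/

section Play

variable {V P O : Type*} {ans : P → V → O} {S : Strategy P O} {R : Set (ℕ → V)}

/-! Suppose that a route `r` on `G` is never located. Then it never meets a vertex probed at that
moment, since the answer 0 gives the position away. Lift `r` to a restricted route `w`: in stride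
`i` (counted from 0) it runs along the thread from `r i` to `r (i + 1)`, or stays at its branch
vertex; excursions are not needed. Follow the play of `A` against `w` up to its first terminating
state.

Before that, the state at the start of each stride is among the possible states. For a stay the true
answers are easily recovered. For a move, the ends of the robber's thread are not among the ends of
the thread of a probe `p`; so a geodesic from `p` to the robber leaves the first thread and enters
the second one through ends, and distances in `G` give its length (`exists_corrEnd_dist_le`,
`dist_branch_branch`, `deduceMoves_eq_dist`).

Let the last probe come after `j` moves of stride `i`. The ends belonging to the robber's location
are probed in round `i + 1`, and for `i ≥ 1` also in round `i`. This hits `r (i + 1)` if `j > 0`,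
and `r i` if `j = 0` and `i ≥ 1`: a contradiction. If `i = j = 0`, the answers of round 0 on `G`
determine the answer to the first probe of `A`, hence the start.

An unrestricted win of `A` is also a restricted one: fewer routes shrink the robber set, which still
contains the true position. -/

theorem length_play (w : ℕ → V) (t : ℕ) : (play ans S w t).length = t := by
  induction t with
  | zero => rfl
  | succ t ih => simp [play, ih]

theorem play_prefix (w : ℕ → V) {s t : ℕ} (h : s ≤ t) : play ans S w s <+: play ans S w t := by
  induction t, h using Nat.le_induction with
  | base => exact List.prefix_refl _
  | succ t _ ih => exact ih.trans (List.prefix_append _ _)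

theorem eq_play_of_prefix (w : ℕ → V) {h : List O} {t : ℕ} (hp : h <+: play ans S w t) :
    h = play ans S w h.length := by
  have hl : h.length ≤ t := by simpa [length_play] using hp.length_le
  exact List.IsPrefix.eq_of_length
    (List.prefix_of_prefix_length_le hp (play_prefix w hl) (by simp [length_play]))
    (by simp [length_play])

theorem getD_play (w : ℕ → V) {s t : ℕ} (h : s < t) (d : O) :
    (play ans S w t).getD s d = ans (S (play ans S w s)) (w s) := by
  obtain ⟨l, hl⟩ := play_prefix (ans := ans) (S := S) w (Nat.succ_le_of_lt h)
  rw [← hl, List.getD_append _ _ _ _ (by simp [length_play])]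
  simp [play, length_play]

theorem play_succ_inj {w w' : ℕ → V} {t : ℕ}
    (h : play ans S w (t + 1) = play ans S w' (t + 1)) :
    play ans S w t = play ans S w' t ∧
      ans (S (play ans S w' t)) (w t) = ans (S (play ans S w' t)) (w' t) := by
  have h1 := List.append_inj h (by simp [length_play])
  refine ⟨h1.1, ?_⟩
  have h2 := h1.2
  rw [h1.1] at h2
  simpa using h2

theorem robberSet_play_succ (w : ℕ → V) (t : ℕ) :
    robberSet ans R S (play ans S w (t + 1)) =
      {x | ∃ w' ∈ R, play ans S w' (t + 1) = play ans S w (t + 1) ∧ w' t = x} := by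
  ext x
  constructor
  · rintro ⟨w', hw', s, hs, hp, hx⟩
    rw [length_play] at hs
    obtain rfl : t = s := by omega
    exact ⟨w', hw', hp, hx⟩
  · rintro ⟨w', hw', hp, hx⟩
    exact ⟨w', hw', t, length_play _ _, hp, hx⟩

theorem mem_robberSet_play_succ {w : ℕ → V} (hw : w ∈ R) (t : ℕ) :
    w t ∈ robberSet ans R S (play ans S w (t + 1)) := by
  rw [robberSet_play_succ]
  exact ⟨w, hw, rfl, rfl⟩

/-- Before any probe the robber set is empty by definition, so a win takes a probe even on a single
vertex. -/
theorem not_isTerminating_nil : ¬ IsTerminating ans R S [] := by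
  rintro ⟨x, hx⟩
  have : x ∈ robberSet ans R S [] := hx ▸ rfl
  obtain ⟨_, _, _, h, _⟩ := this
  simp at h

theorem isTerminating_play_succ_of_forall {w : ℕ → V} (hw : w ∈ R) {t : ℕ}
    (h : ∀ w' ∈ R, play ans S w' (t + 1) = play ans S w (t + 1) → w' t = w t) :
    IsTerminating ans R S (play ans S w (t + 1)) := by
  refine ⟨w t, Set.Subset.antisymm ?_ ?_⟩
  · rw [robberSet_play_succ]
    rintro x ⟨w', hw', hp, rfl⟩
    exact h w' hw' hp
  · rintro x rfl
    exact mem_robberSet_play_succ hw t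

theorem eq_of_isTerminating_play_succ {w : ℕ → V} {t : ℕ}
    (h : IsTerminating ans R S (play ans S w (t + 1))) {w₁ w₂ : ℕ → V} (hw₁ : w₁ ∈ R)
    (hw₂ : w₂ ∈ R) (h₁ : play ans S w₁ (t + 1) = play ans S w (t + 1))
    (h₂ : play ans S w₂ (t + 1) = play ans S w (t + 1)) : w₁ t = w₂ t := by
  obtain ⟨x, hx⟩ := h
  rw [robberSet_play_succ] at hx
  have e₁ : w₁ t ∈ ({x} : Set V) := hx ▸ ⟨w₁, hw₁, h₁, rfl⟩
  have e₂ : w₂ t ∈ ({x} : Set V) := hx ▸ ⟨w₂, hw₂, h₂, rfl⟩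
  exact (Set.mem_singleton_iff.1 e₁).trans (Set.mem_singleton_iff.1 e₂).symm

/-- A strategy that wins against a larger set of routes wins against a smaller one. -/
theorem IsCopWinning.mono {R' : Set (ℕ → V)} (hR : R ⊆ R') (h : IsCopWinning ans R' S) :
    IsCopWinning ans R S := by
  intro w hw
  obtain ⟨t, ht⟩ := h w (hR hw)
  cases t with
  | zero => exact absurd ht not_isTerminating_nil
  | succ t =>
    exact ⟨t + 1, isTerminating_play_succ_of_forall hw fun w' hw' hp =>
      eq_of_isTerminating_play_succ ht (hR hw') (hR hw) hp rfl⟩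

theorem play_mem_copStrategyGraph {w : ℕ → V} (hw : w ∈ R) {t : ℕ}
    (h : ∀ s < t, ¬ IsTerminating ans R S (play ans S w s)) :
    play ans S w t ∈ copStrategyGraph ans R S := by
  refine ⟨⟨w, hw, by rw [length_play]⟩, fun h' hp hne => ?_⟩
  have e := eq_play_of_prefix w hp
  rw [e]
  apply h
  have hl : h'.length ≤ t := by simpa [length_play] using hp.length_le
  refine lt_of_le_of_ne hl fun hlt => hne ?_
  rw [e, hlt]

end Play

/-! ### Vertices and edges of the subdivision. -/

section Subdivision

variable {V : Type*} {G : SimpleGraph V} {m : ℕ}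

/-- Degenerate threads are branch vertices, so a stay and a move share one formula in the lifted
route. -/
theorem threadPoint_self (u : V) {k : ℕ} (hk : k ≤ m) :
    threadPoint m u u k = Pi.single u m := by
  rw [threadPoint, ← Pi.single_add, Nat.sub_add_cancel hk]

theorem threadPoint_zero (u v : V) : threadPoint m u v 0 = Pi.single u m := by
  simp [threadPoint]

theorem threadPoint_top (u v : V) : threadPoint m u v m = Pi.single v m := by
  simp [threadPoint]

theorem threadPoint_symm (u v : V) {k : ℕ} (hk : k ≤ m) :
    threadPoint m u v k = threadPoint m v u (m - k) := by
  rw [threadPoint, threadPoint, Nat.sub_sub_self hk, add_comm]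

/-- The vertex of the subdivision at distance `k` from `u` on the thread from `u` to `v`. -/
noncomputable def threadVertex (m : ℕ) {u v : V} (h : v = u ∨ G.Adj u v) (k : ℕ) (hk : k ≤ m) :
    SubdivVertex G m :=
  ⟨threadPoint m u v k, by
    rcases h with rfl | h
    · exact Or.inl ⟨v, threadPoint_self v hk⟩
    · exact Or.inr ⟨u, v, h, k, hk, rfl⟩⟩

theorem corrEnd_branch (hm : 1 ≤ m) (v : V) : corrEnd (branch G m v) = {v} := by
  ext a
  by_cases h : a = v <;> (simp [corrEnd, branch, h]; try omega)

theorem branch_injective (hm : 1 ≤ m) : Function.Injective (branch G m) := by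
  intro a b h
  have := corrEnd_branch (G := G) hm a
  rw [h, corrEnd_branch hm] at this
  simpa using this.symm

theorem mem_corrEnd_of_val_eq {x : SubdivVertex G m} {u v a : V} {k : ℕ}
    (hx : x.1 = threadPoint m u v k) (ha : a ∈ corrEnd x) : a = u ∨ a = v := by
  by_contra! h
  apply ha
  rw [hx]
  simp [threadPoint, h.1, h.2]

theorem corrEnd_of_inner {x : SubdivVertex G m} {u v : V} {k : ℕ}
    (hx : x.1 = threadPoint m u v k) (h0 : 0 < k) (hk : k < m) : corrEnd x = {u, v} := by
  ext a
  constructor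
  · exact mem_corrEnd_of_val_eq hx
  · rintro (rfl | rfl) <;> simp only [corrEnd, Set.mem_ofPred_eq, hx, threadPoint] <;>
      simp <;> omega

theorem subdiv_adj_of_succ {x y : SubdivVertex G m} {u v : V} (h : G.Adj u v) {k : ℕ} (hk : k < m)
    (hx : x.1 = threadPoint m u v k) (hy : y.1 = threadPoint m u v (k + 1)) :
    (subdiv G m).Adj x y := by
  refine (SimpleGraph.fromRel_adj _ _ _).2 ⟨fun e => ?_, Or.inl ⟨u, v, h, k, hk, hx, hy⟩⟩
  -- The weights at `v` are `k` and `k + 1`.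
  have := congrFun (hx.symm.trans ((congrArg Subtype.val e).trans hy)) v
  simp [threadPoint, h.ne'] at this

/-- Adjacent vertices of the subdivision are consecutive on a thread, in this order. -/
theorem exists_of_subdiv_adj {x y : SubdivVertex G m} (h : (subdiv G m).Adj x y) :
    ∃ u v, G.Adj u v ∧ ∃ k < m, x.1 = threadPoint m u v k ∧ y.1 = threadPoint m u v (k + 1) := by
  rcases ((SimpleGraph.fromRel_adj _ _ _).1 h).2 with h | ⟨u, v, h, k, hk, hx, hy⟩
  · exact h
  · refine ⟨v, u, h.symm, m - (k + 1), by omega, ?_, ?_⟩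
    · rw [hy, threadPoint_symm _ _ hk]
    · rw [hx, threadPoint_symm _ _ hk.le]
      congr 1
      omega

/-! ### Walks and distances in the subdivision. -/

theorem exists_walk_thread {u v : V} (h : G.Adj u v) {k : ℕ} (hk : k ≤ m)
    {x y : SubdivVertex G m} (hx : x = branch G m u) (hy : y.1 = threadPoint m u v k) :
    ∃ W : (subdiv G m).Walk x y, W.length = k := by
  induction k generalizing y with
  | zero =>
    obtain rfl : x = y := by
      apply Subtype.ext
      rw [hy, hx, threadPoint_zero]
      rfl
    exact ⟨.nil, rfl⟩
  | succ k ih =>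
    obtain ⟨W, hW⟩ := ih (y := threadVertex m (Or.inr h) k (by omega)) (by omega) rfl
    exact ⟨W.concat (subdiv_adj_of_succ h hk rfl hy), by simp [hW]⟩

theorem exists_walk_branch {a b : V} (W : G.Walk a b) :
    ∃ W' : (subdiv G m).Walk (branch G m a) (branch G m b), W'.length = m * W.length := by
  induction W with
  | nil => exact ⟨.nil, rfl⟩
  | @cons u v w h p ih =>
    obtain ⟨W', hW'⟩ := ih
    obtain ⟨W'', hW''⟩ := exists_walk_thread (m := m) h le_rfl (y := branch G m v) rfl
      (threadPoint_top u v).symm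
    exact ⟨W''.append W', by simp [hW', hW'']; ring⟩

theorem exists_thread_walk (x : SubdivVertex G m) :
    ∃ u, Nonempty ((subdiv G m).Walk (branch G m u) x) := by
  rcases x.2 with ⟨v, hv⟩ | ⟨u, v, h, k, hk, hx⟩
  · obtain rfl : branch G m v = x := Subtype.ext hv.symm
    exact ⟨v, ⟨.nil⟩⟩
  · exact ⟨u, ⟨(exists_walk_thread h hk rfl hx).choose⟩⟩

theorem subdiv_connected (hG : G.Connected) (m : ℕ) : (subdiv G m).Connected := by
  have : Nonempty V := hG.nonempty
  have : Nonempty (SubdivVertex G m) := ⟨branch G m (Classical.arbitrary V)⟩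
  refine SimpleGraph.Connected.mk fun x y => ?_
  obtain ⟨u, ⟨p⟩⟩ := exists_thread_walk x
  obtain ⟨v, ⟨q⟩⟩ := exists_thread_walk y
  obtain ⟨W⟩ := hG.preconnected u v
  exact ⟨(p.reverse.append (exists_walk_branch W).choose).append q⟩

theorem dist_branch_le_of_val_eq {u v : V} (h : v = u ∨ G.Adj u v) {k : ℕ} (hk : k ≤ m)
    {x : SubdivVertex G m} (hx : x.1 = threadPoint m u v k) :
    (subdiv G m).dist (branch G m u) x ≤ k := by
  rcases h with rfl | h
  · obtain rfl : branch G m v = x := Subtype.ext (hx.trans (threadPoint_self v hk)).symm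
    simp
  · obtain ⟨W, hW⟩ := exists_walk_thread h hk rfl hx
    exact hW ▸ SimpleGraph.dist_le W

/-- A function that changes by at most one along each edge is bounded by the distance. -/
theorem sub_le_dist_of_lipschitz {X : Type*} {H : SimpleGraph X} (hH : H.Connected) (f : X → ℤ)
    (hf : ∀ x y, H.Adj x y → f y - f x ≤ 1) (x y : X) : f y - f x ≤ H.dist x y := by
  obtain ⟨W, hW⟩ := hH.exists_walk_length_eq_dist x y
  rw [← hW]
  clear hW
  induction W with
  | nil => simp
  | cons h p ih =>
    have := hf _ _ h
    push_cast [SimpleGraph.Walk.length_cons]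
    linarith

theorem dist_sub_dist_le_one (hG : G.Connected) (a : V) {u v : V} (h : G.Adj u v) :
    (G.dist a v : ℤ) - G.dist a u ≤ 1 := by
  have := hG.dist_triangle (u := a) (v := u) (w := v)
  rw [SimpleGraph.dist_eq_one_iff_adj.2 h] at this
  omega

theorem sum_threadPoint [Fintype V] (u v : V) {k : ℕ} (hk : k ≤ m) (d : V → ℤ) :
    ∑ b, (threadPoint m u v k b : ℤ) * d b = (m - k) * d u + k * d v := by
  simp [threadPoint, Pi.single_apply, add_mul, Finset.sum_add_distrib, Nat.cast_sub hk]

/-- The upper bound lifts a geodesic of `G`. For the lower bound, interpolate `m * G.dist a ·`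
linearly along the threads by means of the weights: this changes by at most one along each edge. -/
theorem dist_branch_branch [Finite V] (hG : G.Connected) (a b : V) :
    (subdiv G m).dist (branch G m a) (branch G m b) = m * G.dist a b := by
  have := Fintype.ofFinite V
  apply le_antisymm
  · obtain ⟨W, hW⟩ := hG.exists_walk_length_eq_dist a b
    obtain ⟨W', hW'⟩ := exists_walk_branch (m := m) W
    exact (SimpleGraph.dist_le W').trans_eq (by rw [hW', hW])
  · have key := sub_le_dist_of_lipschitz (subdiv_connected hG m)
      (fun x => ∑ c, (x.1 c : ℤ) * G.dist a c) (fun x y h => by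
        obtain ⟨u, v, h, k, hk, hx, hy⟩ := exists_of_subdiv_adj h
        simp only [hx, hy]
        rw [sum_threadPoint u v hk, sum_threadPoint u v hk.le]
        have := dist_sub_dist_le_one hG a h
        push_cast
        linarith) (branch G m a) (branch G m b)
    simp only [branch, Pi.single_apply] at key
    simp only [Nat.cast_ite, Nat.cast_zero, ite_mul, zero_mul, Finset.sum_ite_eq',
      Finset.mem_univ, if_true, SimpleGraph.dist_self, mul_zero, sub_zero] at key
    exact_mod_cast key

/-- The weight at `u` starts at `m` and drops by at most one per edge. -/
theorem sub_le_dist_branch (hG : G.Connected) (u : V) (x : SubdivVertex G m) :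
    (m : ℤ) - x.1 u ≤ (subdiv G m).dist (branch G m u) x := by
  have key := sub_le_dist_of_lipschitz (subdiv_connected hG m)
    (fun x => - (x.1 u : ℤ)) (fun x y h => by
      obtain ⟨v, w, h, k, hk, hx, hy⟩ := exists_of_subdiv_adj h
      simp only [hx, hy, threadPoint, Pi.add_apply, Pi.single_apply]
      split_ifs <;> push_cast <;> omega) (branch G m u) x
  simpa [branch, sub_eq_add_neg, add_comm] using key

theorem dist_branch_of_val_eq (hG : G.Connected) {u v : V} (h : G.Adj u v) {k : ℕ} (hk : k ≤ m)
    {x : SubdivVertex G m} (hx : x.1 = threadPoint m u v k) :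
    (subdiv G m).dist (branch G m u) x = k := by
  apply le_antisymm (dist_branch_le_of_val_eq (Or.inr h) hk hx)
  have := sub_le_dist_branch hG u x
  rw [hx] at this
  simp [threadPoint, h.ne, Nat.cast_sub hk] at this
  exact this

/-- A geodesic leaves the thread of its first vertex through one of the ends. -/
theorem exists_corrEnd_dist_le (hG : G.Connected) (hm : 1 ≤ m) {p x : SubdivVertex G m}
    (hne : corrEnd p ≠ corrEnd x) :
    ∃ a ∈ corrEnd p, (subdiv G m).dist (branch G m a) p + (subdiv G m).dist (branch G m a) x ≤
      (subdiv G m).dist p x := by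
  obtain ⟨W, hW⟩ := (subdiv_connected hG m).exists_walk_length_eq_dist p x
  rw [← hW]
  -- The bound is proved for the length of any walk, so that the induction can pass to the tail.
  clear hW
  have branch_case : ∀ {p x : SubdivVertex G m} (W : (subdiv G m).Walk p x) (v : V),
      p = branch G m v → ∃ a ∈ corrEnd p, (subdiv G m).dist (branch G m a) p +
        (subdiv G m).dist (branch G m a) x ≤ W.length := by
    rintro p x W v rfl
    refine ⟨v, by simp [corrEnd_branch hm], ?_⟩
    simpa using SimpleGraph.dist_le W
  induction W with
  | nil => exact absurd rfl hne
  | @cons p q x h W ih =>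
    obtain ⟨u, v, huv, k, hk, hp, hq⟩ := exists_of_subdiv_adj h
    by_cases h0 : k = 0
    · subst h0
      exact branch_case (.cons h W) u (Subtype.ext (hp.trans (threadPoint_zero u v)))
    have hcp := corrEnd_of_inner hp (by omega) hk
    have hpq : (subdiv G m).dist q p = 1 := SimpleGraph.dist_eq_one_iff_adj.2 h.symm
    by_cases h1 : k + 1 = m
    · obtain rfl : q = branch G m v :=
        Subtype.ext (hq.trans (by rw [h1, threadPoint_top]; rfl))
      refine ⟨v, by simp [hcp], ?_⟩
      have := SimpleGraph.dist_le W
      rw [hpq, SimpleGraph.Walk.length_cons]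
      omega
    -- The next vertex is still inside the same thread, so its exit serves for `p` at an extra cost
    -- of at most one.
    · have hcq := corrEnd_of_inner hq (by omega) (by omega)
      obtain ⟨a, ha, hle⟩ := ih (by rwa [hcq, ← hcp])
      refine ⟨a, by rwa [hcp, ← hcq], ?_⟩
      have := (subdiv_connected hG m).dist_triangle (u := branch G m a) (v := q) (w := p)
      rw [SimpleGraph.Walk.length_cons]
      omega

theorem exists_corrEnd_dist_branch [Finite V] (hG : G.Connected) (hm : 1 ≤ m)
    (p : SubdivVertex G m) (v : V) :
    ∃ a ∈ corrEnd p, m * G.dist a v + (subdiv G m).dist (branch G m a) p ≤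
      (subdiv G m).dist p (branch G m v) := by
  by_cases h : corrEnd p = corrEnd (branch G m v)
  · refine ⟨v, by simp [h, corrEnd_branch hm], ?_⟩
    rw [SimpleGraph.dist_self, SimpleGraph.dist_comm]
    simp
  · obtain ⟨a, ha, hle⟩ := exists_corrEnd_dist_le hG hm h
    rw [dist_branch_branch hG] at hle
    exact ⟨a, ha, by omega⟩

theorem dist_branch_le_add [Finite V] (hG : G.Connected) (p : SubdivVertex G m) (a v : V) :
    (subdiv G m).dist p (branch G m v) ≤
      m * G.dist a v + (subdiv G m).dist (branch G m a) p := by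
  have := (subdiv_connected hG m).dist_triangle (u := p) (v := branch G m a) (w := branch G m v)
  rw [dist_branch_branch hG, SimpleGraph.dist_comm (u := p) (v := branch G m a)] at this
  omega

/-! ### Correctness of the deduced answers. -/

theorem sInf_eq_of_le_of_exists {s : Set ℕ} {n : ℕ} (h₁ : ∀ k ∈ s, n ≤ k) (h₂ : ∃ k ∈ s, k ≤ n) :
    sInf s = n := by
  obtain ⟨k, hk, hkn⟩ := h₂
  exact le_antisymm ((Nat.sInf_le hk).trans hkn) (h₁ _ (Nat.sInf_mem ⟨k, hk⟩))

theorem deduceStays_eq_dist [Finite V] (hG : G.Connected) (hm : 1 ≤ m) {last : V → Option ℕ}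
    {p : SubdivVertex G m} {v : V} (hl : ∀ a ∈ corrEnd p, last a = some (G.dist a v)) :
    deduceStays G m last p = (subdiv G m).dist p (branch G m v) := by
  apply sInf_eq_of_le_of_exists
  · rintro n ⟨a, ha, d, hd, rfl⟩
    rw [hl a ha, Option.some_inj] at hd
    subst hd
    exact dist_branch_le_add hG p a v
  · obtain ⟨a, ha, hle⟩ := exists_corrEnd_dist_branch hG hm p v
    exact ⟨_, ⟨a, ha, _, hl a ha, rfl⟩, hle⟩

/-- Every candidate is at least the distance by the triangle inequality, and a geodesic realizes
one. The conditions on `u` and `v` matter: were `p` inside the robber's thread, a geodesic could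
avoid both ends. -/
theorem deduceMoves_eq_dist [Finite V] (hG : G.Connected) (hm : 1 ≤ m) {last cur : V → Option ℕ}
    {p x : SubdivVertex G m} {u v : V} (huv : G.Adj u v)
    (hl : ∀ a ∈ corrEnd p, last a = some (G.dist a u))
    (hc : ∀ a ∈ corrEnd p, cur a = some (G.dist a v)) (hu : u ∉ corrEnd p) (hv : v ∉ corrEnd p)
    {j : ℕ} (hj : j ≤ m) (hx : x.1 = threadPoint m u v j) :
    deduceMoves G m last cur j p = (subdiv G m).dist p x := by
  have hu' := dist_branch_of_val_eq hG huv hj hx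
  have hv' := dist_branch_of_val_eq hG huv.symm (Nat.sub_le m j)
    (hx.trans (threadPoint_symm u v hj))
  have htri := fun b => (subdiv_connected hG m).dist_triangle (u := p) (v := branch G m b) (w := x)
  apply sInf_eq_of_le_of_exists
  · rintro n ⟨a, ha, d, ⟨hd, rfl⟩ | ⟨hd, rfl⟩⟩
    · rw [hl a ha, Option.some_inj] at hd
      subst hd
      have := dist_branch_le_add hG p a u
      have := htri u
      omega
    · rw [hc a ha, Option.some_inj] at hd
      subst hd
      have := dist_branch_le_add hG p a v
      have := htri v
      omega
  -- The weights `m - j` and `j` cannot both vanish; an end of `x` then separates `corrEnd x` from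
  -- `corrEnd p`.
  · have hx_ne : ∃ b, b ∈ corrEnd x := by
      by_contra! h
      have h1 := not_not.1 (h u)
      have h2 := not_not.1 (h v)
      rw [hx] at h1 h2
      simp [threadPoint, huv.ne, huv.ne'] at h1 h2
      omega
    obtain ⟨b, hb⟩ := hx_ne
    obtain ⟨a, ha, hle⟩ := exists_corrEnd_dist_le hG hm (p := p) (x := x) (fun e => by
      rcases mem_corrEnd_of_val_eq hx hb with rfl | rfl
      · exact hu (e ▸ hb)
      · exact hv (e ▸ hb))
    -- The exit lemma again, now from `x` towards the exit `a` of `p`.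
    obtain ⟨c, hcx, hle'⟩ := exists_corrEnd_dist_le hG hm (p := x) (x := branch G m a) (fun e => by
      rw [corrEnd_branch hm] at e
      rcases mem_corrEnd_of_val_eq hx (e.symm ▸ rfl : a ∈ corrEnd x) with rfl | rfl
      · exact hu ha
      · exact hv ha)
    rw [dist_branch_branch hG, SimpleGraph.dist_comm (u := x), SimpleGraph.dist_comm (u := c)]
      at hle'
    rcases mem_corrEnd_of_val_eq hx hcx with rfl | rfl
    · exact ⟨_, ⟨a, ha, _, Or.inl ⟨hl a ha, rfl⟩⟩, by omega⟩
    · exact ⟨_, ⟨a, ha, _, Or.inr ⟨hc a ha, rfl⟩⟩, by omega⟩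

/-! ### Restricted routes and the lift of a route on `G`. -/

theorem eq_or_subdiv_adj_of_val_eq {x y : SubdivVertex G m} {u v : V} (h : G.Adj u v) {k l : ℕ}
    (hk : k ≤ m) (hl : l ≤ m) (hx : x.1 = threadPoint m u v k) (hy : y.1 = threadPoint m u v l)
    (hkl : l ≤ k + 1) (hlk : k ≤ l + 1) : y = x ∨ (subdiv G m).Adj x y := by
  obtain rfl | rfl | rfl : l = k ∨ l = k + 1 ∨ k = l + 1 := by omega
  · exact Or.inl (Subtype.ext (hy.trans hx.symm))
  · exact Or.inr (subdiv_adj_of_succ h hl hx hy)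
  · exact Or.inr (subdiv_adj_of_succ h hk hy hx).symm

theorem strideRoutes_subset_routes (hm : 1 ≤ m) : strideRoutes G m ⊆ routes (subdiv G m) := by
  rintro w ⟨b, hb⟩ t
  have hj := Nat.mod_lt t hm
  have ht : t / m * m + t % m = t := Nat.div_add_mod' t m
  rcases hb (t / m) with ⟨h, H⟩ | ⟨-, H⟩ | ⟨-, c, h, H⟩
  · have h1 := H _ hj.le
    have h2 := H (t % m + 1) hj
    rw [ht] at h1
    rw [← add_assoc, ht] at h2
    exact eq_or_subdiv_adj_of_val_eq h hj.le hj h1 h2 le_rfl (by omega)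
  · have h1 := H _ hj.le
    have h2 := H (t % m + 1) hj
    rw [ht] at h1
    rw [← add_assoc, ht] at h2
    exact Or.inl (h2.trans h1.symm)
  · have h1 := H _ hj.le
    have h2 := H (t % m + 1) hj
    rw [ht] at h1
    rw [← add_assoc, ht] at h2
    exact eq_or_subdiv_adj_of_val_eq h (by omega) (by omega) h1 h2 (by omega) (by omega)

/-- The route on the subdivision that follows the route `r` on `G` without excursions. -/
noncomputable def liftRoute (hm : 1 ≤ m) {r : ℕ → V} (hr : r ∈ routes G) (t : ℕ) :
    SubdivVertex G m :=
  threadVertex m (hr (t / m)) (t % m) (Nat.mod_lt t hm).le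

theorem liftRoute_val (hm : 1 ≤ m) {r : ℕ → V} (hr : r ∈ routes G) (i : ℕ) {j : ℕ} (hj : j ≤ m) :
    (liftRoute hm hr (i * m + j)).1 = threadPoint m (r i) (r (i + 1)) j := by
  rcases hj.lt_or_eq with hj | rfl
  · have h1 : (i * m + j) / m = i := by
      rw [mul_comm, Nat.mul_add_div (by omega), Nat.div_eq_of_lt hj, add_zero]
    have h2 : (i * m + j) % m = j := by
      rw [mul_comm, Nat.mul_add_mod, Nat.mod_eq_of_lt hj]
    simp only [liftRoute, threadVertex, h1, h2]
  -- At `j = m` the definition already uses the next thread; both threads give the branch vertex of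
  -- `r (i + 1)`.
  · have h1 : (i * j + j) / j = i + 1 := by
      rw [← Nat.succ_mul, Nat.mul_div_cancel _ hm]
    have h2 : (i * j + j) % j = 0 := by
      rw [← Nat.succ_mul, Nat.mul_mod_left]
    simp only [liftRoute, threadVertex, h1, h2]
    rw [threadPoint_zero, threadPoint_top]

theorem liftRoute_eq_branch (hm : 1 ≤ m) {r : ℕ → V} (hr : r ∈ routes G) {i j : ℕ} (hj : j ≤ m)
    (h : r (i + 1) = r i) : liftRoute hm hr (i * m + j) = branch G m (r i) :=
  Subtype.ext (by rw [liftRoute_val hm hr i hj, h, threadPoint_self _ hj]; rfl)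

theorem liftRoute_mem (hm : 1 ≤ m) {r : ℕ → V} (hr : r ∈ routes G) :
    liftRoute hm hr ∈ strideRoutes G m := by
  refine ⟨r, fun i => ?_⟩
  rcases hr i with h | h
  · exact Or.inr (Or.inl ⟨h, fun j hj => liftRoute_eq_branch hm hr hj h⟩)
  · exact Or.inl ⟨h, fun j hj => liftRoute_val hm hr i hj⟩

theorem liftRoute_zero (hm : 1 ≤ m) {r : ℕ → V} (hr : r ∈ routes G) :
    liftRoute hm hr 0 = branch G m (r 0) := by
  apply Subtype.ext
  have := liftRoute_val hm hr 0 (Nat.zero_le m)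
  rw [zero_mul, zero_add] at this
  rw [this, threadPoint_zero]
  rfl

end Subdivision

/-! ### The strategy on `G` and its win. -/

section CopStrategy

variable {V : Type*} {G : SimpleGraph V} {m : ℕ} {A : SubsStrategy G m}

theorem isTerminating_of_mem_probe (hG : G.Connected) {S : MultiStrategy V} {r : ℕ → V}
    (hr : r ∈ routes G) {t : ℕ} (h : r t ∈ S (play (multiAns G) S r t)) :
    IsTerminating (multiAns G) (routes G) S (play (multiAns G) S r (t + 1)) := by
  refine isTerminating_play_succ_of_forall hr fun w _ hw => ?_
  have := congrFun (play_succ_inj hw).2 (r t)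
  simp only [multiAns, if_pos h, Option.some_inj, SimpleGraph.dist_self] at this
  exact (hG.dist_eq_zero_iff.1 this).symm

/-- Hence the default `none`, read by `copStrategy` beyond the recorded history, is harmless. -/
theorem possibleStates_congr {D D' : ℕ → V → Option ℕ} {i : ℕ} (h : ∀ k ≤ i, D k = D' k) :
    possibleStates G m A D i = possibleStates G m A D' i := by
  induction i with
  | zero => rfl
  | succ i ih =>
    simp only [possibleStates]
    rw [ih fun k hk => h k (by omega), h i (by omega), h (i + 1) le_rfl]

theorem advance_eq_play {w : ℕ → SubdivVertex G m} {f : ℕ → SubdivVertex G m → ℕ} {s n : ℕ}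
    (h : ∀ j < n, f j (A (play (distAns (subdiv G m)) A w (s + j))) =
      distAns (subdiv G m) (A (play (distAns (subdiv G m)) A w (s + j))) (w (s + j))) :
    advance A f (play (distAns (subdiv G m)) A w s) n =
      play (distAns (subdiv G m)) A w (s + n) := by
  induction n with
  | zero => rfl
  | succ n ih =>
    rw [advance, ih fun j hj => h j (by omega), h n (by omega)]
    rfl

theorem copStrategy_play_succ (r : ℕ → V) (i : ℕ) :
    copStrategy G m A (play (multiAns G) (copStrategy G m A) r (i + 1)) =
      ⋃ φ ∈ possibleStates G m A (fun t => multiAns G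
        (copStrategy G m A (play (multiAns G) (copStrategy G m A) r t)) (r t)) i,
        ⋃ l ∈ ({i + 1, i + 2} : Set ℕ), levelProbes G m A φ l ∪ leafProbes G m A φ l := by
  -- Only the outer occurrence is to be unfolded, not those inside the play.
  generalize hS : copStrategy G m A = S
  nth_rw 1 [← hS]
  rw [copStrategy]
  split
  · rename_i h
    simp [length_play] at h
  · rename_i k h
    rw [length_play] at h
    obtain rfl : i = k := by omega
    rw [possibleStates_congr fun k hk => getD_play r (Nat.lt_succ_of_le hk) _]

theorem levelProbes_anti {φ φ' : List ℕ} (h : φ <+: φ') (l : ℕ) :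
    levelProbes G m A φ' l ⊆ levelProbes G m A φ l :=
  Set.biUnion_subset_biUnion_left fun _ hψ => ⟨hψ.1, h.trans hψ.2.1, hψ.2.2⟩

theorem leafProbes_anti {φ φ' : List ℕ} (h : φ <+: φ') (l : ℕ) :
    leafProbes G m A φ' l ⊆ leafProbes G m A φ l :=
  Set.biUnion_subset_biUnion_left fun _ hψ => ⟨hψ.1, h.trans hψ.2.1, hψ.2.2⟩

/-- The strategy on `G` locates every robber if `A` locates every restricted robber. -/
theorem isCopWinning_copStrategy [Finite V] (hG : G.Connected) (hm : 1 ≤ m)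
    (hA : IsCopWinning (distAns (subdiv G m)) (strideRoutes G m) A) :
    IsCopWinning (multiAns G) (routes G) (copStrategy G m A) := by
  intro r hr
  by_contra! hnever
  set S := copStrategy G m A with hS
  set Q : ℕ → Set V := fun t => S (play (multiAns G) S r t) with hQ
  set D : ℕ → V → Option ℕ := fun t => multiAns G (Q t) (r t) with hD
  have hmiss : ∀ t, r t ∉ Q t := fun t h => hnever _ (isTerminating_of_mem_probe hG hr h)
  have hans : ∀ {t a}, a ∈ Q t → D t a = some (G.dist a (r t)) := fun h => if_pos h
  have hQ0 : Q 0 = levelProbes G m A [] 1 := rfl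
  have hQs : ∀ i, Q (i + 1) = ⋃ φ ∈ possibleStates G m A D i, ⋃ l ∈ ({i + 1, i + 2} : Set ℕ),
      levelProbes G m A φ l ∪ leafProbes G m A φ l := fun i => copStrategy_play_succ r i
  clear_value D Q
  set w := liftRoute hm hr with hw
  have hwR : w ∈ strideRoutes G m := liftRoute_mem hm hr
  set pl := play (distAns (subdiv G m)) A w with hpl
  have hex := hA w hwR
  obtain ⟨T, hT, hTmin⟩ : ∃ T, IsStrideTerminating G m A (pl T) ∧
      ∀ s < T, ¬ IsStrideTerminating G m A (pl s) :=
    ⟨Nat.find hex, Nat.find_spec hex, fun s hs => Nat.find_min hex hs⟩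
  have hgraph : ∀ s ≤ T, pl s ∈ strideGraph G m A := fun s hs =>
    play_mem_copStrategyGraph hwR fun k hk => hTmin k (by omega)
  have hprobe : ∀ i j, j < m → i * m + j < T →
      corrEnd (A (pl (i * m + j))) ⊆ levelProbes G m A (pl (i * m)) (i + 1) := by
    intro i j hj hlt
    refine Set.subset_biUnion_of_mem (u := fun ψ => corrEnd (A ψ))
      (show pl (i * m + j) ∈ _ from ⟨hgraph _ hlt.le, play_prefix w (by omega), hTmin _ hlt, ?_⟩)
    rw [hpl, length_play, mul_comm, Nat.mul_add_div (by omega), Nat.div_eq_of_lt hj, add_zero]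
  have hnext : ∀ i, pl (i * m) ∈ possibleStates G m A D i →
      levelProbes G m A (pl (i * m)) (i + 1) ∪ leafProbes G m A (pl (i * m)) (i + 1) ⊆ Q (i + 1) ∧
      levelProbes G m A (pl (i * m)) (i + 2) ∪ leafProbes G m A (pl (i * m)) (i + 2) ⊆
        Q (i + 1) := by
    intro i hi
    rw [hQs]
    constructor <;> intro a ha <;> simp only [Set.mem_iUnion]
    · exact ⟨_, hi, i + 1, Or.inl rfl, ha⟩
    · exact ⟨_, hi, i + 2, Or.inr rfl, ha⟩
  -- The second half is why two levels are probed at once: the deduction for level `i + 1` needs its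
  -- probes both in round `i` and in round `i + 1`.
  have htrack : ∀ i, i * m < T → pl (i * m) ∈ possibleStates G m A D i ∧
      levelProbes G m A (pl (i * m)) (i + 1) ⊆ Q i := by
    intro i
    induction i with
    | zero =>
      intro _
      rw [zero_mul]
      exact ⟨rfl, hQ0.symm.subset⟩
    | succ i ih =>
      intro hlt
      have hmul : (i + 1) * m = i * m + m := Nat.succ_mul i m
      obtain ⟨hmem, hcur⟩ := ih (by omega)
      obtain ⟨hn1, hn2⟩ := hnext i hmem
      refine ⟨⟨pl (i * m), hmem, ?_, hgraph _ hlt.le, hTmin _ hlt⟩,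
        (levelProbes_anti (play_prefix w (by omega)) _).trans
          (Set.subset_union_left.trans hn2)⟩
      have hl1 : ∀ a ∈ levelProbes G m A (pl (i * m)) (i + 1),
          D i a = some (G.dist a (r i)) := fun a ha => hans (hcur ha)
      have hl2 : ∀ a ∈ levelProbes G m A (pl (i * m)) (i + 1),
          D (i + 1) a = some (G.dist a (r (i + 1))) := fun a ha => hans (hn1 (Or.inl ha))
      rw [hmul]
      rcases hr i with hstay | hmove
      · rw [deduceAndUpdate, if_neg]
        · refine Or.inr (advance_eq_play fun j hj => ?_).symm
          rw [deduceStays_eq_dist hG hm (v := r i)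
            fun a ha => hl1 a (hprobe i j hj (by omega) ha), distAns,
            hw, liftRoute_eq_branch hm hr hj.le hstay]
        · rintro ⟨a, ha, hne⟩
          rw [hl1 a ha, hl2 a ha, hstay] at hne
          exact hne rfl
      · have : pl (i * m + m) = advance A (deduceMoves G m (D i) (D (i + 1))) (pl (i * m)) m := by
          refine (advance_eq_play fun j hj => ?_).symm
          have hsub := hprobe i j hj (by omega)
          exact deduceMoves_eq_dist hG hm hmove (fun a ha => hl1 a (hsub ha))
            (fun a ha => hl2 a (hsub ha)) (fun h => hmiss i (hcur (hsub h)))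
            (fun h => hmiss (i + 1) (hn1 (Or.inl (hsub h)))) hj.le (liftRoute_val hm hr i hj.le)
        -- A move need not change any relevant answer, but both branches keep this state.
        rw [this, deduceAndUpdate]
        split_ifs
        · rfl
        · exact Or.inl rfl
  obtain ⟨t, rfl⟩ : ∃ t, T = t + 1 := by
    refine Nat.exists_eq_succ_of_ne_zero fun h0 => ?_
    subst h0
    exact not_isTerminating_nil hT
  obtain ⟨i, j, hj, rfl⟩ : ∃ i j, j < m ∧ t = i * m + j :=
    ⟨t / m, t % m, Nat.mod_lt t hm, (Nat.div_add_mod' t m).symm⟩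
  have hleaf : corrEnd (w (i * m + j)) ⊆ leafProbes G m A (pl (i * m)) (i + 1) := by
    intro a ha
    simp only [leafProbes, Set.mem_iUnion]
    refine ⟨_, ⟨hgraph _ le_rfl, play_prefix w (by omega), hT, ?_⟩, _,
      mem_robberSet_play_succ hwR _, ha⟩
    rw [hpl, length_play, Nat.add_sub_cancel, mul_comm, Nat.mul_add_div (by omega),
      Nat.div_eq_of_lt hj, add_zero]
  have hi := (htrack i (by omega)).1
  have hval := liftRoute_val hm hr i hj.le
  have hend : r (i + 1) ∉ corrEnd (w (i * m + j)) := fun h =>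
    hmiss (i + 1) ((hnext i hi).1 (Or.inr (hleaf h)))
  obtain rfl : j = 0 := by
    by_contra h0
    apply hend
    rw [corrEnd_of_inner hval (by omega) hj]
    simp
  have hbr : w (i * m + 0) = branch G m (r i) :=
    Subtype.ext (hval.trans (threadPoint_zero _ _))
  cases i with
  | succ i =>
    have hmul : (i + 1) * m = i * m + m := Nat.succ_mul i m
    have hi' := (htrack i (by omega)).1
    -- One round earlier: the lookahead from the preceding stride probes this leaf while the robber
    -- is at its branch vertex.
    refine hmiss (i + 1) ((hnext i hi').2 (Or.inr ?_))
    refine leafProbes_anti (play_prefix w (by omega)) _ (hleaf ?_)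
    rw [hbr, corrEnd_branch hm]
    rfl
  | zero =>
    -- Round 0 probes no leaves, so the start is located by comparing lifts: a route `r'` with the
    -- same answers on `G` gives `A` the same first answer.
    refine hnever 1 (isTerminating_play_succ_of_forall hr fun r' hr' he => ?_)
    have hsub := hprobe 0 0 hm (by simp)
    simp only [zero_mul, add_zero] at hsub hT
    have hans0 : ∀ (r'' : ℕ → V), ∀ a ∈ corrEnd (A []),
        multiAns G (S []) (r'' 0) a = some (G.dist a (r'' 0)) := fun r'' a ha =>
      if_pos (hsub ha)
    have hd : multiAns G (S []) (r' 0) = multiAns G (S []) (r 0) := (play_succ_inj he).2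
    have heq : (subdiv G m).dist (A []) (branch G m (r' 0)) =
        (subdiv G m).dist (A []) (branch G m (r 0)) := by
      rw [← deduceStays_eq_dist hG hm (hans0 r'), hd, deduceStays_eq_dist hG hm (hans0 r)]
    apply branch_injective (G := G) hm
    rw [← liftRoute_zero hm hr', ← liftRoute_zero hm hr]
    refine eq_of_isTerminating_play_succ hT (liftRoute_mem hm hr') hwR ?_ rfl
    simp only [play, distAns, hw, liftRoute_zero, heq]

end CopStrategy

end RobberLocating

theorem theorem3 {V : Type*} [Finite V] (G : SimpleGraph V) (hG : G.Connected) (m : ℕ)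
    (hm : 1 ≤ m) (A : RobberLocating.SubsStrategy G m) :
    (RobberLocating.IsCopWinning (RobberLocating.distAns (RobberLocating.subdiv G m))
        (RobberLocating.strideRoutes G m) A →
      RobberLocating.IsCopWinning (RobberLocating.multiAns G) (RobberLocating.routes G)
        (RobberLocating.copStrategy G m A)) ∧
    (RobberLocating.IsCopWinning (RobberLocating.distAns (RobberLocating.subdiv G m))
        (RobberLocating.routes (RobberLocating.subdiv G m)) A →
      RobberLocating.IsCopWinning (RobberLocating.multiAns G) (RobberLocating.routes G)
        (RobberLocating.copStrategy G m A)) := by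
  exact ⟨RobberLocating.isCopWinning_copStrategy hG hm, fun h =>
    RobberLocating.isCopWinning_copStrategy hG hm
      (h.mono (RobberLocating.strideRoutes_subset_routes hm))⟩
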